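/- Let $\alpha,\lambda>0$, and let $\gamma_{\alpha,\lambda}$ be a gamma random variable, with density $\frac{\lambda^{\alpha}}{\Gamma(\alpha)}x^{\alpha-1}e^{-\lambda x}$ on $(0,\infty)$. Let $(Y(t))_{t\ge 0}$ be a background driving Lévy process of $\log\gamma_{\alpha,\lambda}$, that is, a real càdlàg Lévy process with $\mathbb{E}[\log(1+|Y(1)|)]<\infty$ such that the random integral $$\int_0^\infty e^{-s}\,dY(s):=\lim_{T\to\infty}\int_{(0,T]}e^{-s}\,dY(s)$$ exists almost surely and has the same distribution as $\log\gamma_{\alpha,\lambda}$; here $\int_{(0,T]}e^{-s}\,dY(s)=e^{-T}Y(T)-Y(0)+\int_0^T Y(s)e^{-s}\,ds$. Let $G$ be the distribution of $Y(1)$ (the background driving distribution of $\log\gamma_{\alpha,\lambda}$). Then: (a) $G$ has a finite mean, and $\int_{\mathbb{R}} x\,dG(x)=-\log\lambda+\Psi(\alpha)$, where $\Psi=\Gamma'/\Gamma$ is the digamma function; (b) $G$ has a finite second moment, and its variance is $$\int_0^\infty x^2e^{-\alpha x}\,\bigl[\alpha+(1-\alpha)e^{-x}\bigr]\,(1-e^{-x})^{-2}\,dx<\infty;$$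 (c) for every $\beta>0$, the absolute moment $\int_{\mathbb{R}}|x|^{\beta}\,dG(x)$ is finite. -/

import Mathlib

open MeasureTheory ProbabilityTheory Filter Topology Set
open scoped NNReal

/-- The law of `log γ_{α,lam}`, where `γ_{α,lam}` has the gamma density
`lam ^ α / Γ(α) * x ^ (α - 1) * exp (-lam * x)` on `(0, ∞)`. -/
noncomputable def logGammaLaw (α lam : ℝ) : Measure ℝ :=
  (gammaMeasure α lam).map Real.log

/-- A real Lévy process `(Y t)`, `t ≥ 0`: it starts at `0`, has independent and stationary
increments, and its paths are càdlàg, almost surely. -/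
structure IsLevyProcess {Ω : Type*} [MeasurableSpace Ω] (Y : ℝ≥0 → Ω → ℝ) (P : Measure Ω) :
    Prop where
  measurable : ∀ t, Measurable (Y t)
  zero : ∀ᵐ ω ∂P, Y 0 ω = 0
  indepIncrements : HasIndepIncrements Y P
  stationaryIncrements : ∀ s t : ℝ≥0, IdentDistrib (fun ω => Y (s + t) ω - Y s ω) (Y t) P P
  cadlag : ∀ᵐ ω ∂P, ∀ t : ℝ≥0,
    ContinuousWithinAt (fun s => Y s ω) (Ioi t) t ∧
      ∃ l : ℝ, Tendsto (fun s => Y s ω) (𝓝[<] t) (𝓝 l)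

/-- The pathwise Riemann-Stieltjes integral `∫_{(0,T]} exp (-s) dY(s)` along a càdlàg path `y`,
given by integration by parts:
`exp (-T) * y T - y 0 - ∫_0^T y s d(exp (-s))`. -/
noncomputable def expIntegral (y : ℝ≥0 → ℝ) (T : ℝ≥0) : ℝ :=
  Real.exp (-(T : ℝ)) * y T - y 0 + ∫ s in (0 : ℝ)..(T : ℝ), y s.toNNReal * Real.exp (-s)

/-- `Y` is a background driving Lévy process of the distribution `μ`: a Lévy process with
`E[log (1 + |Y 1|)] < ∞` for which the random integral `∫_0^∞ exp (-s) dY(s)`, the almost sure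
limit of the integrals over `(0, T]` as `T → ∞`, exists and has law `μ`. -/
structure IsBackgroundDrivingLevyProcess {Ω : Type*} [MeasurableSpace Ω]
    (Y : ℝ≥0 → Ω → ℝ) (P : Measure Ω) (μ : Measure ℝ) : Prop where
  isLevyProcess : IsLevyProcess Y P
  logMoment : Integrable (fun ω => Real.log (1 + |Y 1 ω|)) P
  randomIntegral : ∃ X : Ω → ℝ, HasLaw X μ P ∧
    ∀ᵐ ω ∂P, Tendsto (fun T : ℝ≥0 => expIntegral (fun s => Y s ω) T) atTop (𝓝 (X ω))

/-- The background driving distribution: the law of the background driving variable `Y 1`,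
that is, the measure with distribution function `a ↦ P (Y 1 ≤ a)`. -/
noncomputable def backgroundDrivingDistribution {Ω : Type*} [MeasurableSpace Ω]
    (Y : ℝ≥0 → Ω → ℝ) (P : Measure Ω) : Measure ℝ :=
  P.map (Y 1)

/-! Let `φ` be the characteristic function of the log-gamma law and `η` the characteristic exponent
of `Y`. Splitting the random integral at time `t` gives `φ(u) = exp(∫₀ᵗ η(e⁻ˢu) ds) · φ(e⁻ᵗu)`
(`IsLevyProcess.charFun_limit_eq`), and differentiating at `t = 0` gives `η(u) φ(u) = u φ'(u)`
(`exponent_mul_eq_of_selfdecomposable`). Since `φ(u) = lam^(-iu) Γ(α + iu) / Γ(α)`, this identifies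
`η(u) = iu (-log lam + ψ(α + iu))`, with `ψ` the digamma function.

Hence `G` has characteristic function `exp η` on `[-1, 1]`, which is smooth at `0`. For a finite
measure this forces moments of every order (`memLp_of_contDiffAt_charFun`). The mean is read off
from `η'(0)`, and the variance is `-η''(0) = 2 ψ'(α) = 2 ∑ 1/(α + n)²`. Expanding `(1 - e⁻ˣ)⁻²` into
a power series and integrating termwise turns the integral of the theorem into the same sum
(`integral_trigamma`).

Only `u ∈ [-1, 1]` and times `m/(N n)` with a fixed `N` are needed. On that range the principal
logarithm defines `η`, so neither the Lévy–Khintchine formula nor a continuous choice of branch on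
the whole line is required. -/

/-! ### Moments from smoothness of the characteristic function -/

lemma integrable_pow_mul_of_memLp {μ : Measure ℝ} [IsFiniteMeasure μ] {n : ℕ}
    (h : MemLp id n μ) {f : ℝ → ℝ} (hf : Measurable f) {C : ℝ} (hC : ∀ x, |f x| ≤ C) :
    Integrable (fun x : ℝ => x ^ n * f x) μ := by
  refine Integrable.mul_bdd (c := C) ?_ hf.aestronglyMeasurable (Eventually.of_forall hC)
  have := h.integrable_norm_pow'
  refine (integrable_norm_iff (by fun_prop)).1 ?_
  simpa using this

/-- A measure whose integrals of `x ^ (2 * k) * (1 - cos (t * x))` are of order `t ^ 2` has a moment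
of order `2 * k + 2`. -/
lemma memLp_of_integral_one_sub_cos_le {μ : Measure ℝ} [IsFiniteMeasure μ] {k : ℕ}
    (hk : MemLp id (2 * k : ℕ) μ) {C : ℝ}
    (hC : ∀ᶠ t in 𝓝 (0 : ℝ), ∫ x, x ^ (2 * k) * (1 - Real.cos (t * x)) ∂μ ≤ C * t ^ 2) :
    MemLp id (2 * (k + 1) : ℕ) μ := by
  have ht : Tendsto (fun n : ℕ => 1 / ((n : ℝ) + 1)) atTop (𝓝 0) :=
    tendsto_one_div_add_atTop_nhds_zero_nat
  have hev := ht.eventually hC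
  set f : ℕ → ℝ → ℝ := fun n x =>
    x ^ (2 * k) * (1 - Real.cos (1 / ((n : ℝ) + 1) * x)) * ((n : ℝ) + 1) ^ 2 with hf
  have hf0 : ∀ n x, 0 ≤ f n x := fun n x => by
    have := Real.cos_le_one (1 / ((n : ℝ) + 1) * x)
    have h2 : 0 ≤ x ^ (2 * k) := by rw [pow_mul]; positivity
    have h3 : 0 ≤ 1 - Real.cos (1 / ((n : ℝ) + 1) * x) := by linarith
    positivity
  have hint : ∀ n, Integrable (f n) μ := fun n => by
    refine (integrable_pow_mul_of_memLp hk (f := fun x => 1 - Real.cos (1 / ((n : ℝ) + 1) * x))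
      (by fun_prop) (C := 2) fun x => ?_).mul_const _
    have h1 := Real.cos_le_one (1 / ((n : ℝ) + 1) * x)
    have h2 := Real.neg_one_le_cos (1 / ((n : ℝ) + 1) * x)
    rw [abs_le]; constructor <;> linarith
  have hlim : ∀ x, Tendsto (fun n => f n x) atTop (𝓝 (x ^ (2 * k) * (x ^ 2 / 2))) := fun x => by
    have hl : Tendsto (fun t : ℝ => (1 - Real.cos (t * x)) / t ^ 2) (𝓝[≠] 0) (𝓝 (x ^ 2 / 2)) := by
      have hs : Tendsto (fun t : ℝ => x ^ 2 / 2 * (Real.sinc (t * x / 2)) ^ 2) (𝓝[≠] 0)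
          (𝓝 (x ^ 2 / 2)) := by
        have : Continuous fun t : ℝ => x ^ 2 / 2 * (Real.sinc (t * x / 2)) ^ 2 := by
          have := Real.continuous_sinc
          fun_prop
        simpa using (this.tendsto 0).mono_left nhdsWithin_le_nhds
      refine hs.congr' ?_
      filter_upwards [self_mem_nhdsWithin] with t ht
      have ht : t ≠ 0 := ht
      rcases eq_or_ne x 0 with rfl | hx
      · simp
      rw [Real.sinc_of_ne_zero (by positivity)]
      have : Real.cos (t * x) = 1 - 2 * Real.sin (t * x / 2) ^ 2 := by
        rw [← Real.cos_two_mul_eq_one_sub]; ring_nf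
      rw [this]
      field_simp
      ring
    have hn : Tendsto (fun n : ℕ => 1 / ((n : ℝ) + 1)) atTop (𝓝[≠] 0) :=
      tendsto_nhdsWithin_iff.2 ⟨ht, Eventually.of_forall fun n => by
        simp only [mem_compl_iff, mem_singleton_iff]; positivity⟩
    refine ((hl.comp hn).const_mul (x ^ (2 * k))).congr fun n => ?_
    simp only [hf, Function.comp]
    field_simp
  -- Fatou's lemma along `t = 1/(n+1)`, since `(1 - cos (t x)) / t² → x²/2`.
  have hle : ∫⁻ x, ENNReal.ofReal (x ^ (2 * k) * (x ^ 2 / 2)) ∂μ ≤ ENNReal.ofReal C := by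
    calc ∫⁻ x, ENNReal.ofReal (x ^ (2 * k) * (x ^ 2 / 2)) ∂μ
        = ∫⁻ x, liminf (fun n => ENNReal.ofReal (f n x)) atTop ∂μ := by
          refine lintegral_congr fun x => ?_
          exact ((ENNReal.continuous_ofReal.tendsto _).comp (hlim x)).liminf_eq.symm
      _ ≤ liminf (fun n => ∫⁻ x, ENNReal.ofReal (f n x) ∂μ) atTop :=
          lintegral_liminf_le fun n => by fun_prop
      _ ≤ ENNReal.ofReal C := by
          refine liminf_le_of_frequently_le' (Eventually.frequently ?_)
          filter_upwards [hev] with n hn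
          rw [← ofReal_integral_eq_lintegral_ofReal (hint n) (Eventually.of_forall (hf0 n))]
          refine ENNReal.ofReal_le_ofReal ?_
          rw [integral_mul_const]
          calc _ ≤ C * (1 / ((n : ℝ) + 1)) ^ 2 * ((n : ℝ) + 1) ^ 2 := by gcongr
            _ = C := by field_simp
  have hi : Integrable (fun x : ℝ => x ^ (2 * k) * (x ^ 2 / 2)) μ := by
    refine (lintegral_ofReal_ne_top_iff_integrable (by fun_prop) (Eventually.of_forall fun x => ?_)).1
      (hle.trans_lt ENNReal.ofReal_lt_top).ne
    simp only [Pi.zero_apply]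
    rw [pow_mul]; positivity
  rw [← integrable_norm_rpow_iff (by fun_prop) (by simp) (by finiteness)]
  refine (hi.mul_const 2).congr (Eventually.of_forall fun x => ?_)
  simp only [id, Real.norm_eq_abs, ENNReal.toReal_natCast, Real.rpow_natCast]
  rw [pow_mul |x|, sq_abs, pow_mul, pow_succ]
  ring

/-- Differentiating `2k` times under the integral brings out `i^(2k) = (-1)^k`; the real part leaves
the cosine. -/
lemma integral_pow_mul_one_sub_cos {μ : Measure ℝ} [IsFiniteMeasure μ] {k : ℕ}
    (hk : MemLp id (2 * k : ℕ) μ) (t : ℝ) :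
    ∫ x, x ^ (2 * k) * (1 - Real.cos (t * x)) ∂μ =
      (-1) ^ k * (iteratedDeriv (2 * k) (charFun μ) 0).re
        - (-1) ^ k * (iteratedDeriv (2 * k) (charFun μ) t).re := by
  have key : ∀ t : ℝ, (-1) ^ k * (iteratedDeriv (2 * k) (charFun μ) t).re
      = ∫ x, x ^ (2 * k) * Real.cos (t * x) ∂μ := fun t => by
    have hI : Integrable (fun x : ℝ => (x : ℂ) ^ (2 * k) * Complex.exp (t * x * Complex.I)) μ := by
      refine Integrable.mul_bdd (c := 1) ?_ (by fun_prop) (Eventually.of_forall fun x => ?_)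
      · have := (integrable_pow_mul_of_memLp hk (f := fun _ => 1) (by fun_prop) (C := 1)
          (by simp)).ofReal (𝕜 := ℂ)
        simpa using this
      · rw [← Complex.ofReal_mul, Complex.norm_exp_ofReal_mul_I]
    rw [iteratedDeriv_charFun hk, pow_mul, Complex.I_sq]
    have h1 : ((-1 : ℂ) ^ k) = (((-1 : ℝ) ^ k : ℝ) : ℂ) := by push_cast; rfl
    rw [h1, Complex.re_ofReal_mul, ← mul_assoc, ← mul_pow]
    rw [← RCLike.re_eq_complex_re, ← integral_re hI]
    simp only [mul_neg, mul_one, neg_neg, one_pow, one_mul]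
    refine integral_congr_ae (Eventually.of_forall fun x => ?_)
    simp only [RCLike.re_eq_complex_re]
    rw [← Complex.ofReal_pow, Complex.re_ofReal_mul, ← Complex.ofReal_mul,
      Complex.exp_ofReal_mul_I_re]
  rw [key, key, ← integral_sub]
  · refine integral_congr_ae (Eventually.of_forall fun x => ?_)
    simp; ring
  · exact integrable_pow_mul_of_memLp hk (by fun_prop) (C := 1) fun x => Real.abs_cos_le_one _
  · exact integrable_pow_mul_of_memLp hk (by fun_prop) (C := 1) fun x => Real.abs_cos_le_one _

/-- The derivative vanishes at `0` and is differentiable there, so it is `O(s)`; the mean value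
inequality on the ball of radius `|t|` gives the square. -/
lemma eventually_le_sq_of_isLocalMax {g : ℝ → ℝ} (hg : ContDiffAt ℝ 2 g 0) (hm : IsLocalMax g 0) :
    ∃ C, ∀ᶠ t in 𝓝 (0 : ℝ), g 0 - g t ≤ C * t ^ 2 := by
  have hd0 : deriv g 0 = 0 := hm.deriv_eq_zero
  have hdd : DifferentiableAt ℝ (deriv g) 0 := by
    have : ContDiffAt ℝ 1 (deriv g) 0 := hg.derivWithin (by norm_num)
    exact this.differentiableAt (by norm_num)
  have hO := hdd.isBigO_sub
  simp only [hd0, sub_zero] at hO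
  obtain ⟨C, hC⟩ := hO.bound
  have hdiff : ∀ᶠ t in 𝓝 (0 : ℝ), DifferentiableAt ℝ g t :=
    (hg.eventually (by simp)).mono fun t ht => ht.differentiableAt (by norm_num)
  obtain ⟨ε, hε, hball⟩ := Metric.eventually_nhds_iff_ball.1 (hC.and hdiff)
  refine ⟨|C|, ?_⟩
  filter_upwards [Metric.ball_mem_nhds (0 : ℝ) hε] with t ht
  have hsub : ∀ s ∈ Metric.closedBall (0 : ℝ) |t|, s ∈ Metric.ball (0 : ℝ) ε := fun s hs => by
    simp only [Metric.mem_closedBall, Metric.mem_ball, dist_zero_right, Real.norm_eq_abs] at *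
    exact hs.trans_lt ht
  have hC0 : ∀ s ∈ Metric.closedBall (0 : ℝ) |t|, ‖deriv g s‖ ≤ |C| * |t| := fun s hs => by
    refine (hball s (hsub s hs)).1.trans ?_
    simp only [Metric.mem_closedBall, dist_zero_right] at hs
    exact mul_le_mul (le_abs_self C) hs (norm_nonneg _) (abs_nonneg _)
  have := Convex.norm_image_sub_le_of_norm_deriv_le (fun s hs => (hball s (hsub s hs)).2) hC0
    (convex_closedBall 0 |t|) (x := t) (y := 0) (by simp) (by simp)
  calc g 0 - g t ≤ ‖g 0 - g t‖ := le_abs_self _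
    _ ≤ _ := this
    _ = |C| * t ^ 2 := by rw [zero_sub, norm_neg, Real.norm_eq_abs, mul_assoc, ← sq, sq_abs]

lemma ContDiffAt.iteratedDeriv_infty {f : ℝ → ℂ} {x : ℝ} (hf : ContDiffAt ℝ (⊤ : ℕ∞) f x) (n : ℕ) :
    ContDiffAt ℝ (⊤ : ℕ∞) (iteratedDeriv n f) x := by
  induction n with
  | zero => simpa using hf
  | succ n ih =>
    rw [iteratedDeriv_succ]
    exact ih.derivWithin (by simp)

/-- A finite measure whose characteristic function is smooth at `0` has moments of all orders. -/
lemma memLp_of_contDiffAt_charFun {μ : Measure ℝ} [IsFiniteMeasure μ]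
    (h : ContDiffAt ℝ (⊤ : ℕ∞) (charFun μ) 0) (n : ℕ) : MemLp id n μ := by
  have hev : ∀ k : ℕ, MemLp id (2 * k : ℕ) μ := fun k => by
    induction k with
    | zero => simpa using measurable_id.aestronglyMeasurable
    | succ k ih =>
      have hcos := integral_pow_mul_one_sub_cos ih
      set g : ℝ → ℝ := fun t => (-1) ^ k * (iteratedDeriv (2 * k) (charFun μ) t).re with hg
      have hgc : ContDiffAt ℝ 2 g 0 := by
        have h1 : ContDiffAt ℝ 2 (iteratedDeriv (2 * k) (charFun μ)) 0 :=
          (h.iteratedDeriv_infty (2 * k)).of_le (by norm_cast)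
        exact contDiffAt_const.mul (Complex.reCLM.contDiff.contDiffAt.comp _ h1)
      -- `g 0 - g t` is the integral of the nonnegative function `x^(2k) (1 - cos (t x))`.
      have hmax : IsLocalMax g 0 := Eventually.of_forall fun t => by
        have h0 : 0 ≤ ∫ x, x ^ (2 * k) * (1 - Real.cos (t * x)) ∂μ := integral_nonneg fun x => by
          have := Real.cos_le_one (t * x)
          have h2 : 0 ≤ x ^ (2 * k) := by rw [pow_mul]; positivity
          exact mul_nonneg h2 (by linarith)
        rw [hcos t] at h0
        exact sub_nonneg.1 h0
      obtain ⟨C, hC⟩ := eventually_le_sq_of_isLocalMax hgc hmax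
      refine memLp_of_integral_one_sub_cos_le ih (C := C) ?_
      filter_upwards [hC] with t ht
      rw [hcos t]
      exact ht
  refine (hev n).mono_exponent ?_
  norm_cast
  omega

/-! ### Digamma and its derivative as series -/

lemma Complex.ne_neg_natCast_of_re_pos {z : ℂ} (hz : 0 < z.re) (m : ℕ) : z ≠ -m := fun h => by
  rw [h] at hz
  simp at hz
  linarith [(Nat.cast_nonneg m : (0 : ℝ) ≤ m)]

lemma Complex.analyticAt_Gamma_of_re_pos {z : ℂ} (hz : 0 < z.re) :
    AnalyticAt ℂ Complex.Gamma z := by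
  refine DifferentiableOn.analyticAt (s := {z | 0 < z.re}) (fun w hw => ?_)
    ((isOpen_lt continuous_const Complex.continuous_re).mem_nhds hz)
  exact (Complex.differentiableAt_Gamma w
    (Complex.ne_neg_natCast_of_re_pos hw)).differentiableWithinAt

lemma Complex.analyticAt_digamma_of_re_pos {z : ℂ} (hz : 0 < z.re) :
    AnalyticAt ℂ Complex.digamma z :=
  (analyticAt_Gamma_of_re_pos hz).deriv.div (analyticAt_Gamma_of_re_pos hz)
    (Complex.Gamma_ne_zero (ne_neg_natCast_of_re_pos hz))

lemma Real.differentiableAt_Gamma_of_pos {x : ℝ} (hx : 0 < x) : DifferentiableAt ℝ Real.Gamma x :=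
  Real.differentiableAt_Gamma fun m h => by
    linarith [(Nat.cast_nonneg m : (0 : ℝ) ≤ m)]

lemma Complex.digamma_ofReal {x : ℝ} (hx : 0 < x) :
    Complex.digamma x = (logDeriv Real.Gamma x : ℝ) := by
  have h1 : HasDerivAt (fun y : ℝ => Complex.Gamma y) (deriv Complex.Gamma x) x :=
    (Complex.analyticAt_Gamma_of_re_pos (by simpa using hx)).differentiableAt.hasDerivAt.comp_ofReal
  have h2 : HasDerivAt (fun y : ℝ => Complex.Gamma y) (deriv Real.Gamma x : ℝ) x := by
    simp_rw [Complex.Gamma_ofReal]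
    exact (Real.differentiableAt_Gamma_of_pos hx).hasDerivAt.ofReal_comp
  rw [Complex.digamma_def, logDeriv_apply, logDeriv_apply, h1.unique h2, Complex.Gamma_ofReal,
    Complex.ofReal_div]

lemma Real.logDeriv_Gamma_add_one {x : ℝ} (hx : 0 < x) :
    logDeriv Real.Gamma (x + 1) = logDeriv Real.Gamma x + 1 / x := by
  have h := Complex.digamma_apply_add_one (x : ℂ)
    (Complex.ne_neg_natCast_of_re_pos (by simpa using hx))
  rw [← Complex.ofReal_one, ← Complex.ofReal_add, Complex.digamma_ofReal (by positivity),
    Complex.digamma_ofReal hx] at h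
  rw [one_div]
  exact_mod_cast h

lemma Real.logDeriv_Gamma_add_nat {x : ℝ} (hx : 0 < x) (N : ℕ) :
    logDeriv Real.Gamma (x + N) =
      logDeriv Real.Gamma x + ∑ n ∈ Finset.range N, 1 / (x + n) := by
  induction N with
  | zero => simp
  | succ N ih =>
    rw [Finset.sum_range_succ, ← add_assoc, ← ih, ← Real.logDeriv_Gamma_add_one (by positivity)]
    push_cast
    ring_nf

lemma Real.monotoneOn_logDeriv_Gamma : MonotoneOn (logDeriv Real.Gamma) (Ioi 0) := by
  have hd : ∀ x ∈ Ioi (0 : ℝ), HasDerivAt (Real.log ∘ Real.Gamma) (logDeriv Real.Gamma x) x :=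
    fun x hx => (Real.differentiableAt_Gamma_of_pos hx).hasDerivAt.log (Real.Gamma_pos_of_pos hx).ne'
  have h := Real.convexOn_log_Gamma.monotoneOn_deriv fun x hx => (hd x hx).differentiableAt
  exact h.congr fun x hx => (hd x hx).deriv

/-- By log-convexity of `Γ` the digamma function is monotone, and by its recurrence it grows by at
most `(M + 1)/N` from `N` to `N + M + 1`. For `M ≥ x` both arguments lie in that interval. -/
lemma Real.tendsto_logDeriv_Gamma_sub {x : ℝ} (hx : 0 < x) :
    Tendsto (fun N : ℕ => logDeriv Real.Gamma (1 + N) - logDeriv Real.Gamma (x + N)) atTop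
      (𝓝 0) := by
  obtain ⟨M, hM⟩ := exists_nat_ge x
  refine squeeze_zero_norm' (a := fun N : ℕ => (M + 1 : ℝ) / N) ?_
    (tendsto_const_div_atTop_nhds_zero_nat _)
  filter_upwards [eventually_ge_atTop 1] with N hN
  have hN : (1 : ℝ) ≤ N := by exact_mod_cast hN
  have hM0 : (0 : ℝ) ≤ M := Nat.cast_nonneg M
  have hmono := Real.monotoneOn_logDeriv_Gamma
  have hb : logDeriv Real.Gamma (N + (M + 1 : ℕ)) - logDeriv Real.Gamma N ≤ (M + 1 : ℝ) / N := by
    rw [Real.logDeriv_Gamma_add_nat (by positivity), add_sub_cancel_left]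
    calc ∑ n ∈ Finset.range (M + 1), 1 / ((N : ℝ) + n)
        ≤ ∑ n ∈ Finset.range (M + 1), 1 / (N : ℝ) := by
          gcongr with n
          linarith [(Nat.cast_nonneg n : (0 : ℝ) ≤ n)]
      _ = _ := by simp; ring
  push_cast at hb
  have h1 : logDeriv Real.Gamma N ≤ logDeriv Real.Gamma (1 + N) :=
    hmono (by simp; linarith) (by simp; linarith) (by linarith)
  have h2 : logDeriv Real.Gamma N ≤ logDeriv Real.Gamma (x + N) :=
    hmono (by simp; linarith) (by simp; linarith) (by linarith)
  have h3 : logDeriv Real.Gamma (1 + N) ≤ logDeriv Real.Gamma (N + (M + 1)) :=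
    hmono (by simp; linarith) (by simp; linarith) (by linarith)
  have h4 : logDeriv Real.Gamma (x + N) ≤ logDeriv Real.Gamma (N + (M + 1)) :=
    hmono (by simp; linarith) (by simp; linarith) (by linarith)
  rw [Real.norm_eq_abs, abs_le]
  constructor <;> linarith

lemma summable_one_div_add_nat_sq {x : ℝ} (hx : 0 < x) :
    Summable fun n : ℕ => 1 / (x + n) ^ 2 := by
  have h := (Real.summable_one_div_nat_add_rpow x 2).2 (by norm_num)
  refine h.congr fun n => ?_
  rw [abs_of_pos (by positivity), add_comm, Real.rpow_two]

lemma hasDerivAt_digamma_term (n : ℕ) {y : ℝ} (hy : 0 < y) :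
    HasDerivAt (fun y : ℝ => 1 / ((1 : ℝ) + n) - 1 / (y + n)) (1 / (y + n) ^ 2) y := by
  have h := (((hasDerivAt_id y).add_const (n : ℝ)).fun_inv (by simp; positivity)).const_sub
    (1 / ((1 : ℝ) + n))
  simp only [id] at h
  simp only [one_div] at h ⊢
  exact h.congr_deriv (by ring)

/-- The recurrence, iterated `N` times from `1` and from `y`, gives the partial sums up to an error
that tends to `0`. -/
lemma Real.logDeriv_Gamma_eq_tsum {y : ℝ} (hy : 0 < y)
    (hs : Summable fun n : ℕ => 1 / ((1 : ℝ) + n) - 1 / (y + n)) :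
    logDeriv Real.Gamma y =
      logDeriv Real.Gamma 1 + ∑' n : ℕ, (1 / ((1 : ℝ) + n) - 1 / (y + n)) := by
  have ht := hs.hasSum.tendsto_sum_nat
  have ht2 : Tendsto (fun N : ℕ => ∑ n ∈ Finset.range N, (1 / ((1 : ℝ) + n) - 1 / (y + n))) atTop
      (𝓝 (logDeriv Real.Gamma y - logDeriv Real.Gamma 1 + 0)) := by
    refine ((Real.tendsto_logDeriv_Gamma_sub hy).const_add
      (logDeriv Real.Gamma y - logDeriv Real.Gamma 1)).congr fun N => ?_
    rw [Finset.sum_sub_distrib, Real.logDeriv_Gamma_add_nat one_pos,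
      Real.logDeriv_Gamma_add_nat hy]
    ring
  rw [tendsto_nhds_unique ht ht2]
  ring

lemma Real.hasDerivAt_logDeriv_Gamma {x : ℝ} (hx : 0 < x) :
    HasDerivAt (logDeriv Real.Gamma) (∑' n : ℕ, 1 / (x + n) ^ 2) x := by
  -- On `(a, ∞)` the differentiated series is dominated by `∑ 1/(a + n)²`. Taking `a < 1` keeps the
  -- point `1` inside, where every term vanishes and summability is trivial.
  obtain ⟨a, ha0, ha⟩ := exists_between (lt_min hx one_pos)
  obtain ⟨hax, ha1⟩ := lt_min_iff.1 ha
  have hd : ∀ (n : ℕ) (y : ℝ), y ∈ Ioi a →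
      HasDerivAt (fun y : ℝ => 1 / ((1 : ℝ) + n) - 1 / (y + n)) (1 / (y + n) ^ 2) y :=
    fun n y hy => hasDerivAt_digamma_term n (ha0.trans hy)
  have hb : ∀ (n : ℕ) (y : ℝ), y ∈ Ioi a → ‖1 / (y + n) ^ 2‖ ≤ 1 / (a + n) ^ 2 :=
    fun n y hy => by
      have hy' : a < y := hy
      rw [Real.norm_of_nonneg (by positivity)]
      gcongr
  have h1 : Summable fun n : ℕ => 1 / ((1 : ℝ) + n) - 1 / ((1 : ℝ) + n) := by simp
  have hs : ∀ y ∈ Ioi a, Summable fun n : ℕ => 1 / ((1 : ℝ) + n) - 1 / (y + n) := fun y hy =>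
    summable_of_summable_hasDerivAt_of_isPreconnected
      (g := fun (n : ℕ) (y : ℝ) => 1 / ((1 : ℝ) + n) - 1 / (y + n))
      (summable_one_div_add_nat_sq ha0) isOpen_Ioi isPreconnected_Ioi hd hb ha1 h1 hy
  have hder := hasDerivAt_tsum_of_isPreconnected
      (g := fun (n : ℕ) (y : ℝ) => 1 / ((1 : ℝ) + n) - 1 / (y + n))
      (summable_one_div_add_nat_sq ha0) isOpen_Ioi isPreconnected_Ioi hd hb ha1 h1 hax
  refine (hder.const_add (logDeriv Real.Gamma 1)).congr_of_eventuallyEq ?_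
  filter_upwards [Ioi_mem_nhds hax] with y hy
  exact Real.logDeriv_Gamma_eq_tsum (ha0.trans hy) (hs y hy)

/-- A complex derivative that is known to exist can be computed along the real line. -/
lemma Complex.hasDerivAt_digamma_ofReal {x : ℝ} (hx : 0 < x) :
    HasDerivAt Complex.digamma ((∑' n : ℕ, 1 / (x + n) ^ 2 : ℝ) : ℂ) x := by
  have h := (Complex.analyticAt_digamma_of_re_pos
    (z := (x : ℂ)) (by simpa using hx)).differentiableAt.hasDerivAt
  have h2 : HasDerivAt (fun y : ℝ => Complex.digamma y) ((∑' n : ℕ, 1 / (x + n) ^ 2 : ℝ) : ℂ) x := by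
    refine (Real.hasDerivAt_logDeriv_Gamma hx).ofReal_comp.congr_of_eventuallyEq ?_
    filter_upwards [Ioi_mem_nhds hx] with y hy
    exact Complex.digamma_ofReal hy
  rwa [← h.comp_ofReal.unique h2]

/-! ### The variance integral as a series -/

lemma integral_sq_mul_exp_neg_mul_Ioi {a : ℝ} (ha : 0 < a) :
    ∫ x in Ioi (0 : ℝ), x ^ 2 * Real.exp (-(a * x)) = 2 / a ^ 3 := by
  have h := Real.integral_rpow_mul_exp_neg_mul_Ioi (a := 3) (by norm_num) ha
  have hG : Real.Gamma 3 = 2 := by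
    have := Real.Gamma_nat_eq_factorial 2
    rw [show ((2 : ℕ) : ℝ) + 1 = 3 by norm_num] at this
    rw [this]
    norm_num [Nat.factorial]
  rw [hG] at h
  norm_num at h
  rw [h]
  norm_cast
  field_simp

lemma integrableOn_sq_mul_exp_neg_mul_Ioi {a : ℝ} (ha : 0 < a) :
    IntegrableOn (fun x : ℝ => x ^ 2 * Real.exp (-(a * x))) (Ioi 0) :=
  -- The Bochner integral of a non-integrable function is `0`, so a nonzero value proves
  -- integrability.
  Integrable.of_integral_ne_zero (by rw [integral_sq_mul_exp_neg_mul_Ioi ha]; positivity)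

/-- With `q = e⁻ˣ`, `(α + (1 - α) q)/(1 - q)² = α/(1 - q) + q/(1 - q)² = ∑ (α + n) qⁿ`. -/
lemma hasSum_trigamma_integrand {α x : ℝ} (hx : 0 < x) :
    HasSum (fun n : ℕ => (α + n) * (x ^ 2 * Real.exp (-((α + n) * x))))
      (x ^ 2 * Real.exp (-α * x) * (α + (1 - α) * Real.exp (-x)) *
        ((1 - Real.exp (-x)) ^ 2)⁻¹) := by
  have hq1 : Real.exp (-x) < 1 := by rw [Real.exp_lt_one_iff]; linarith
  have hq : ‖Real.exp (-x)‖ < 1 := by rwa [Real.norm_of_nonneg (Real.exp_pos _).le]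
  have h1 := (hasSum_geometric_of_norm_lt_one hq).mul_left α
  have h2 := hasSum_coe_mul_geometric_of_norm_lt_one hq
  have h := (h1.add h2).mul_left (x ^ 2 * Real.exp (-α * x))
  have hne : 1 - Real.exp (-x) ≠ 0 := by linarith
  have hsum : x ^ 2 * Real.exp (-α * x) * (α + (1 - α) * Real.exp (-x)) *
        ((1 - Real.exp (-x)) ^ 2)⁻¹ = x ^ 2 * Real.exp (-α * x) *
          (α * (1 - Real.exp (-x))⁻¹ + Real.exp (-x) / (1 - Real.exp (-x)) ^ 2) := by
    field_simp
    ring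
  rw [hsum]
  have hfun : ∀ n : ℕ, (α + n) * (x ^ 2 * Real.exp (-((α + n) * x))) =
      x ^ 2 * Real.exp (-α * x) * (α * Real.exp (-x) ^ n + n * Real.exp (-x) ^ n) := fun n => by
    have : Real.exp (-((α + n) * x)) = Real.exp (-α * x) * Real.exp (-x) ^ n := by
      rw [← Real.exp_nat_mul, ← Real.exp_add]; ring_nf
    rw [this]; ring
  simpa only [hfun] using h

lemma integral_trigamma {α : ℝ} (hα : 0 < α) :
    ∫ x in Ioi (0 : ℝ), x ^ 2 * Real.exp (-α * x) * (α + (1 - α) * Real.exp (-x)) *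
        ((1 - Real.exp (-x)) ^ 2)⁻¹ = 2 * ∑' n : ℕ, 1 / (α + n) ^ 2 := by
  have hI : ∀ n : ℕ, ∫ x in Ioi (0 : ℝ), (α + n) * (x ^ 2 * Real.exp (-((α + n) * x)))
      = 2 * (1 / (α + n) ^ 2) := fun n => by
    rw [integral_const_mul, integral_sq_mul_exp_neg_mul_Ioi (by positivity)]
    have : α + n ≠ 0 := by positivity
    field_simp
  have hsum := (summable_one_div_add_nat_sq hα).mul_left 2
  have h := hasSum_integral_of_summable_integral_norm (μ := volume.restrict (Ioi (0 : ℝ)))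
    (F := fun (n : ℕ) (x : ℝ) => (α + n) * (x ^ 2 * Real.exp (-((α + n) * x))))
    (fun n => (integrableOn_sq_mul_exp_neg_mul_Ioi (by positivity)).const_mul _)
    (hsum.congr fun n => by
      rw [← hI n]
      exact integral_congr_ae (Eventually.of_forall fun x => by
        simp only
        rw [Real.norm_of_nonneg (by positivity)]))
  simp_rw [hI] at h
  rw [← tsum_mul_left, h.tsum_eq]
  refine setIntegral_congr_fun measurableSet_Ioi fun x hx => ?_
  exact (hasSum_trigamma_integrand hx).tsum_eq.symm

lemma integrableOn_trigamma {α : ℝ} (hα : 0 < α) :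
    IntegrableOn (fun x : ℝ => x ^ 2 * Real.exp (-α * x) * (α + (1 - α) * Real.exp (-x)) *
        ((1 - Real.exp (-x)) ^ 2)⁻¹) (Ioi 0) := by
  refine Integrable.of_integral_ne_zero ?_
  rw [integral_trigamma hα]
  have : 0 < ∑' n : ℕ, 1 / (α + n) ^ 2 :=
    (summable_one_div_add_nat_sq hα).tsum_pos (fun n => by positivity) 0 (by positivity)
  positivity

/-! ### The characteristic function of the log-gamma law -/

/-- Since `e^(iu log x) = x^(iu)`, this is the Gamma integral with exponent `α + iu`. -/
lemma charFun_logGammaLaw {α lam : ℝ} (hα : 0 < α) (hlam : 0 < lam) (u : ℝ) :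
    charFun (logGammaLaw α lam) u =
      Complex.exp (-(u * Real.log lam * Complex.I)) * Complex.Gamma (α + u * Complex.I)
        / Complex.Gamma α := by
  rw [logGammaLaw, charFun_apply_real, integral_map Real.measurable_log.aemeasurable (by fun_prop),
    gammaMeasure, integral_withDensity_eq_integral_toReal_smul
      (show Measurable (gammaPDF α lam) from (measurable_gammaPDFReal α lam).ennreal_ofReal)
      (Eventually.of_forall fun x => ENNReal.ofReal_lt_top)]
  have hz : ∀ x, x ∉ Ioi (0 : ℝ) → x ≠ 0 → (gammaPDF α lam x).toReal •
      Complex.exp (u * Real.log x * Complex.I) = 0 := fun x hx hx0 => by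
    have : x < 0 := lt_of_le_of_ne (not_lt.1 hx) hx0
    rw [gammaPDF_of_neg this]
    simp
  rw [← setIntegral_eq_integral_of_ae_compl_eq_zero (s := Ioi 0)
    (by
      filter_upwards [compl_mem_ae_iff.2 (measure_singleton (0 : ℝ))] with x hx0 hx
      exact hz x hx hx0)]
  have hc : ∀ x ∈ Ioi (0 : ℝ), (gammaPDF α lam x).toReal •
      Complex.exp (u * Real.log x * Complex.I) =
      ((lam ^ α / Real.Gamma α : ℝ) : ℂ) *
        ((x : ℂ) ^ ((α + u * Complex.I : ℂ) - 1) * Complex.exp (-(lam * x))) := fun x hx => by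
    have hx : 0 < x := hx
    have hG := Real.Gamma_pos_of_pos hα
    rw [gammaPDF_of_nonneg hx.le, ENNReal.toReal_ofReal (by positivity), Complex.real_smul,
      show (α + u * Complex.I : ℂ) - 1 = ((α - 1 : ℝ) : ℂ) + u * Complex.I by push_cast; ring,
      Complex.cpow_add _ _ (by exact_mod_cast hx.ne'), ← Complex.ofReal_cpow hx.le,
      Complex.cpow_def_of_ne_zero (by exact_mod_cast hx.ne'), ← Complex.ofReal_log hx.le]
    push_cast
    ring_nf
  rw [setIntegral_congr_fun measurableSet_Ioi hc, integral_const_mul,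
    Complex.integral_cpow_mul_exp_neg_mul_Ioi (by simpa using hα) hlam]
  have hl : (lam : ℂ) ≠ 0 := by exact_mod_cast hlam.ne'
  rw [Complex.Gamma_ofReal, one_div, Complex.inv_cpow _ _ (by
    rw [Complex.arg_ofReal_of_nonneg hlam.le]; exact Real.pi_pos.ne),
    Complex.cpow_add _ _ hl, ← Complex.ofReal_cpow hlam.le, Complex.cpow_def_of_ne_zero hl,
    ← Complex.ofReal_log hlam.le, Complex.exp_neg]
  have h1 : ((lam ^ α : ℝ) : ℂ) ≠ 0 := by
    exact_mod_cast (Real.rpow_pos_of_pos hlam α).ne'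
  have h2 : (Real.Gamma α : ℂ) ≠ 0 := by exact_mod_cast (Real.Gamma_pos_of_pos hα).ne'
  have h3 : (u * Real.log lam * Complex.I : ℂ) = Real.log lam * (u * Complex.I) := by ring
  rw [h3]
  have h4 := Complex.exp_ne_zero (Real.log lam * (u * Complex.I))
  push_cast
  field_simp

/-! ### Riemann–Stieltjes sums along càdlàg paths -/

section Deterministic

/-- A function with one-sided limits is bounded on compact intervals. -/
lemma exists_bound_of_cadlag {y : ℝ≥0 → ℝ}
    (hy : ∀ t : ℝ≥0, ContinuousWithinAt y (Ioi t) t ∧ ∃ l : ℝ, Tendsto y (𝓝[<] t) (𝓝 l))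
    (T : ℝ≥0) : ∃ C, ∀ t ≤ T, |y t| ≤ C := by
  have h : ∃ C, ∀ t ∈ Icc 0 T, |y t| ≤ C := by
    refine isCompact_Icc.induction_on (p := fun s => ∃ C, ∀ t ∈ s, |y t| ≤ C) ⟨0, by simp⟩ ?_ ?_ ?_
    · rintro s t hst ⟨C, hC⟩
      exact ⟨C, fun x hx => hC x (hst hx)⟩
    · rintro s t ⟨C, hC⟩ ⟨D, hD⟩
      refine ⟨max C D, fun x hx => ?_⟩
      rcases hx with hx | hx
      · exact (hC x hx).trans (le_max_left _ _)
      · exact (hD x hx).trans (le_max_right _ _)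
    · intro t _
      obtain ⟨hr, l, hl⟩ := hy t
      have e1 : ∀ᶠ s in 𝓝[>] t, |y s| ≤ |y t| + 1 :=
        (hr.abs.eventually (gt_mem_nhds (lt_add_one _))).mono fun _ h => h.le
      have e2 : ∀ᶠ s in 𝓝[<] t, |y s| ≤ |l| + 1 :=
        (hl.abs.eventually (gt_mem_nhds (lt_add_one _))).mono fun _ h => h.le
      have e3 : ∀ᶠ s in 𝓝 t, |y s| ≤ max (|y t| + 1) (|l| + 1) := by
        rw [← nhdsLT_sup_nhdsGE, ← Ioi_insert, nhdsWithin_insert, eventually_sup, eventually_sup]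
        refine ⟨e2.mono fun _ h => h.trans (le_max_right _ _), ?_,
          e1.mono fun _ h => h.trans (le_max_left _ _)⟩
        rw [eventually_pure]
        exact (lt_add_one _).le.trans (le_max_left _ _)
      exact ⟨_, mem_nhdsWithin_of_mem_nhds e3, _, fun x hx => hx⟩
  obtain ⟨C, hC⟩ := h
  exact ⟨C, fun t ht => hC t ⟨zero_le, ht⟩⟩

/-- Right-endpoint Riemann-Stieltjes sums of a bounded right-continuous function. -/
lemma tendsto_sum_integral_smul {E : Type*} [NormedAddCommGroup E] [NormedSpace ℝ E]
    [CompleteSpace E]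
    {f : ℝ → E} {w : ℝ → ℝ} (hw : Continuous w) {T : ℝ} (hT : 0 ≤ T) {C : ℝ}
    (hC : ∀ s ∈ Icc 0 T, ‖f s‖ ≤ C)
    (hf : ∀ s ∈ Ioo 0 T, ContinuousWithinAt f (Ioi s) s) :
    Tendsto (fun n : ℕ => ∑ i ∈ Finset.range n,
      (∫ s in (i * (T / n))..((i + 1 : ℕ) * (T / n)), w s) • f ((i + 1 : ℕ) * (T / n)))
      atTop (𝓝 (∫ s in (0 : ℝ)..T, w s • f s)) := by
  rcases hT.eq_or_lt with rfl | hT0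
  · simp
  -- `F n s` samples `f` at the right endpoint of the mesh interval containing `s`, so
  -- right-continuity gives pointwise convergence and boundedness gives domination.
  set F : ℕ → ℝ → E := fun n s => f (⌈s / (T / n)⌉₊ * (T / n)) with hF
  have hsum : ∀ᶠ n : ℕ in atTop, ∫ s in (0 : ℝ)..T, w s • F n s = ∑ i ∈ Finset.range n,
      (∫ s in (i * (T / n))..((i + 1 : ℕ) * (T / n)), w s) • f ((i + 1 : ℕ) * (T / n)) := by
    filter_upwards [eventually_ge_atTop 1] with n hn
    have hn0 : (0 : ℝ) < n := by exact_mod_cast hn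
    have hd : 0 < T / n := by positivity
    have hEq : ∀ i : ℕ, EqOn (fun s => w s • F n s) (fun s => w s • f ((i + 1 : ℕ) * (T / n)))
        (Ioc (i * (T / n)) ((i + 1 : ℕ) * (T / n))) := fun i s hs => by
      have : ⌈s / (T / n)⌉₊ = i + 1 := by
        rw [Nat.ceil_eq_iff (by simp)]
        exact ⟨by rw [Nat.add_sub_cancel, lt_div_iff₀ hd]; exact hs.1,
          by rw [div_le_iff₀ hd]; exact hs.2⟩
      simp only [hF, this]
    have hle : ∀ i : ℕ, (i * (T / n) : ℝ) ≤ (i + 1 : ℕ) * (T / n) := fun i => by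
      gcongr; simp
    have hint : ∀ i : ℕ, IntervalIntegrable (fun s => w s • F n s) volume
        (i * (T / n)) ((i + 1 : ℕ) * (T / n)) := fun i => by
      rw [intervalIntegrable_iff_integrableOn_Ioc_of_le (hle i),
        integrableOn_congr_fun (hEq i) measurableSet_Ioc,
        ← intervalIntegrable_iff_integrableOn_Ioc_of_le (hle i)]
      exact (hw.smul continuous_const).intervalIntegrable _ _
    have h := intervalIntegral.sum_integral_adjacent_intervals (n := n)
      (a := fun i : ℕ => (i * (T / n) : ℝ)) fun i _ => hint i
    simp only [Nat.cast_zero, zero_mul] at h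
    rw [show (n * (T / n) : ℝ) = T by field_simp] at h
    rw [← h]
    refine Finset.sum_congr rfl fun i _ => ?_
    rw [intervalIntegral.integral_of_le (hle i), setIntegral_congr_fun measurableSet_Ioc (hEq i),
      ← intervalIntegral.integral_of_le (hle i), intervalIntegral.integral_smul_const]
  refine Tendsto.congr' hsum ?_
  obtain ⟨D, hD⟩ := isCompact_Icc.exists_bound_of_continuousOn (hw.continuousOn (s := Icc 0 T))
  refine intervalIntegral.tendsto_integral_filter_of_dominated_convergence (fun _ => D * C)
    ?_ ?_ (by simp) ?_
  · refine Eventually.of_forall fun n => ?_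
    refine hw.aestronglyMeasurable.smul ?_
    refine StronglyMeasurable.aestronglyMeasurable ?_
    have : StronglyMeasurable fun m : ℕ => f (m * (T / n)) := .of_discrete
    exact this.comp_measurable (Nat.measurable_ceil.comp (measurable_id.div_const _))
  · filter_upwards [eventually_ge_atTop 1] with n hn
    have hn0 : (0 : ℝ) < n := by exact_mod_cast hn
    have hd : 0 < T / n := by positivity
    refine Eventually.of_forall fun s hs => ?_
    rw [uIoc_of_le hT] at hs
    rw [norm_smul]
    have h1 := hD s ⟨hs.1.le, hs.2⟩
    refine mul_le_mul h1 (hC _ ⟨by positivity, ?_⟩) (norm_nonneg _) ((norm_nonneg _).trans h1)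
    rw [← le_div_iff₀ hd, show T / (T / n) = (n : ℝ) by field_simp]
    norm_cast
    rw [Nat.ceil_le, div_le_iff₀ hd, show (n * (T / n) : ℝ) = T by field_simp]
    exact hs.2
  · have : ∀ᵐ s : ℝ, s ≠ T := by simp [ae_iff]
    filter_upwards [this] with s hsT hs
    rw [uIoc_of_le hT] at hs
    have hcont : ContinuousWithinAt f (Ici s) s := by
      rw [← continuousWithinAt_Ioi_iff_Ici]
      exact hf s ⟨hs.1, lt_of_le_of_ne hs.2 hsT⟩
    refine Tendsto.const_smul (hcont.tendsto.comp (tendsto_nhdsWithin_iff.2 ⟨?_, ?_⟩)) _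
    · have hup : Tendsto (fun n : ℕ => s + T / n) atTop (𝓝 s) := by
        simpa using (tendsto_const_div_atTop_nhds_zero_nat T).const_add s
      refine tendsto_of_tendsto_of_tendsto_of_le_of_le' tendsto_const_nhds hup ?_ ?_
      · filter_upwards [eventually_ge_atTop 1] with n hn
        have hn0 : (0 : ℝ) < n := by exact_mod_cast hn
        have hd : 0 < T / n := by positivity
        rw [← div_le_iff₀ hd]
        exact Nat.le_ceil _
      · filter_upwards [eventually_ge_atTop 1] with n hn
        have hn0 : (0 : ℝ) < n := by exact_mod_cast hn
        have hd : 0 < T / n := by positivity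
        have h0 : 0 ≤ s / (T / n) := div_nonneg hs.1.le hd.le
        calc (⌈s / (T / n)⌉₊ : ℝ) * (T / n) ≤ (s / (T / n) + 1) * (T / n) := by
              gcongr; exact (Nat.ceil_lt_add_one h0).le
          _ = s + T / n := by field_simp
    · filter_upwards [eventually_ge_atTop 1] with n hn
      have hn0 : (0 : ℝ) < n := by exact_mod_cast hn
      have hd : 0 < T / n := by positivity
      rw [mem_Ici, ← div_le_iff₀ hd]
      exact Nat.le_ceil _

/-- Left-endpoint Riemann sums of a continuous function. -/
lemma tendsto_riemannSum {f : ℝ → ℂ} (hf : Continuous f) {T : ℝ} (hT : 0 ≤ T) :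
    Tendsto (fun n : ℕ => ∑ i ∈ Finset.range n, (T / n : ℝ) • f (i * (T / n)))
      atTop (𝓝 (∫ s in (0 : ℝ)..T, f s)) := by
  obtain ⟨C, hC⟩ := isCompact_Icc.exists_bound_of_continuousOn (hf.continuousOn (s := Icc 0 T))
  have h1 := tendsto_sum_integral_smul (w := fun _ => 1) continuous_const hT hC
    fun s _ => hf.continuousWithinAt
  -- The difference between the left-endpoint and right-endpoint sums.
  have h2 : Tendsto (fun n : ℕ => (T / n : ℝ) • (f 0 - f T)) atTop (𝓝 0) := by
    simpa using (tendsto_const_div_atTop_nhds_zero_nat T).smul_const (f 0 - f T)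
  have h := h1.add h2
  simp only [one_smul, add_zero] at h
  refine h.congr' ?_
  filter_upwards [eventually_ge_atTop 1] with n hn
  have hn0 : (n : ℝ) ≠ 0 := by positivity
  have hi : ∀ i : ℕ, (∫ _ in (i * (T / n) : ℝ)..((i + 1 : ℕ) * (T / n)), (1 : ℝ)) = T / n :=
    fun i => by simp; ring
  simp_rw [hi]
  have ht := Finset.sum_range_sub (fun i : ℕ => (T / n : ℝ) • f (i * (T / n))) n
  rw [Finset.sum_sub_distrib] at ht
  simp only [Nat.cast_zero, zero_mul] at ht
  rw [show (n * (T / n) : ℝ) = T by field_simp] at ht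
  rw [smul_sub, ← neg_sub, ← ht]
  abel

/-- The weighted sums of increments converge to the Riemann-Stieltjes integral of a càdlàg path. -/
lemma tendsto_sum_expIntegral {y : ℝ≥0 → ℝ}
    (hy : ∀ t : ℝ≥0, ContinuousWithinAt y (Ioi t) t ∧ ∃ l : ℝ, Tendsto y (𝓝[<] t) (𝓝 l))
    (T : ℝ≥0) :
    Tendsto (fun n : ℕ => ∑ i ∈ Finset.range n,
      Real.exp (-(i * (T / n))) * (y ((i + 1 : ℕ) * (T / n)) - y (i * (T / n))))
      atTop (𝓝 (expIntegral y T)) := by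
  obtain ⟨C, hC⟩ := exists_bound_of_cadlag hy T
  have h := tendsto_sum_integral_smul (f := fun s => y s.toNNReal) (w := fun s => Real.exp (-s))
    (by fun_prop) T.coe_nonneg (C := C) (fun s hs => hC _ (Real.toNNReal_le_iff_le_coe.2 hs.2)) ?_
  swap
  · intro s hs
    refine ContinuousWithinAt.comp (t := Ioi s.toNNReal) (hy _).1
      continuous_real_toNNReal.continuousWithinAt fun r hr => ?_
    exact (Real.toNNReal_lt_toNNReal_iff (hs.1.trans hr)).2 hr
  have h2 := h.const_add (Real.exp (-(T : ℝ)) * y T - y 0)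
  have hE : Real.exp (-(T : ℝ)) * y T - y 0 + ∫ s in (0 : ℝ)..(T : ℝ),
      Real.exp (-s) • y s.toNNReal = expIntegral y T := by
    simp only [expIntegral, smul_eq_mul, mul_comm]
  rw [← hE]
  refine h2.congr' ?_
  filter_upwards [eventually_ge_atTop 1] with n hn
  have hn0 : (n : ℝ) ≠ 0 := by positivity
  have hn1 : (n : ℝ≥0) ≠ 0 := by positivity
  have hi : ∀ i : ℕ, (∫ s in (i * (T / n) : ℝ)..((i + 1 : ℕ) * (T / n)), Real.exp (-s)) =
      Real.exp (-(i * (T / n))) - Real.exp (-((i + 1 : ℕ) * (T / n))) := fun i => by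
    rw [intervalIntegral.integral_comp_neg (fun s => Real.exp s), integral_exp]
  have hnn : ∀ i : ℕ, ((i * (T / n) : ℝ)).toNNReal = i * (T / n) := fun i => by
    rw [show (i * (T / n) : ℝ) = ((i * (T / n) : ℝ≥0) : ℝ) by push_cast; rfl, Real.toNNReal_coe]
  -- Summation by parts: the telescoping boundary terms turn weighted increments into weights `∫ e⁻ˢ
  -- ds` on right-endpoint values.
  have ht := Finset.sum_range_sub
    (fun i : ℕ => Real.exp (-(i * (T / n) : ℝ)) * y (i * (T / n))) n
  simp only [Nat.cast_zero, zero_mul, neg_zero, Real.exp_zero, one_mul] at ht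
  rw [show (n * (T / n) : ℝ) = T by field_simp, show (n * (T / n) : ℝ≥0) = T by field_simp] at ht
  rw [← ht, ← Finset.sum_add_distrib]
  refine Finset.sum_congr rfl fun i _ => ?_
  rw [hi, hnn, smul_eq_mul]
  ring

end Deterministic

/-! ### Characteristic functions of a Lévy process and of its exponential integrals -/

lemma tendsto_charFun_of_ae_tendsto {Ω ι : Type*} [MeasurableSpace Ω] {P : Measure Ω}
    [IsProbabilityMeasure P] {l : Filter ι} [l.IsCountablyGenerated] {X : ι → Ω → ℝ} {Z : Ω → ℝ}
    (hX : ∀ i, AEMeasurable (X i) P) (hZ : AEMeasurable Z P)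
    (h : ∀ᵐ ω ∂P, Tendsto (fun i => X i ω) l (𝓝 (Z ω))) (u : ℝ) :
    Tendsto (fun i => charFun (P.map (X i)) u) l (𝓝 (charFun (P.map Z) u)) := by
  have hc : ∀ {W : Ω → ℝ}, AEMeasurable W P →
      charFun (P.map W) u = ∫ ω, Complex.exp (u * W ω * Complex.I) ∂P := fun {W} hW => by
    rw [charFun_apply_real, integral_map hW (by fun_prop)]
  simp_rw [fun i => hc (hX i), hc hZ]
  refine tendsto_integral_filter_of_dominated_convergence (fun _ => 1) ?_ ?_ (by simp) ?_
  · refine Eventually.of_forall fun i => ?_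
    have hm : Measurable fun x : ℝ => Complex.exp (u * x * Complex.I) := by fun_prop
    exact (hm.comp_aemeasurable (hX i)).aestronglyMeasurable
  · refine Eventually.of_forall fun i => Eventually.of_forall fun ω => ?_
    rw [← Complex.ofReal_mul, Complex.norm_exp_ofReal_mul_I]
  · filter_upwards [h] with ω hω
    have hm : Continuous fun x : ℝ => Complex.exp (u * x * Complex.I) := by fun_prop
    exact (hm.tendsto _).comp hω

namespace IsLevyProcess

variable {Ω : Type*} [MeasurableSpace Ω] {P : Measure Ω} {Y : ℝ≥0 → Ω → ℝ}

lemma charFun_sum_increments (hY : IsLevyProcess Y P) (c : ℕ → ℝ) (h : ℝ≥0) (n : ℕ) (u : ℝ) :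
    charFun (P.map fun ω => ∑ i ∈ Finset.range n,
      c i * (Y ((i + 1 : ℕ) * h) ω - Y (i * h) ω)) u =
      ∏ i ∈ Finset.range n, charFun (P.map (Y h)) (c i * u) := by
  have hmono : Monotone fun i : ℕ => (i : ℝ≥0) * h := fun i j hij => by
    simp only; gcongr
  have hind := hY.indepIncrements.nat hmono
  have hm : ∀ i : ℕ, Measurable fun ω => Y ((i + 1 : ℕ) * h) ω - Y (i * h) ω := fun i =>
    (hY.measurable _).sub (hY.measurable _)
  have hind2 := hind.comp (fun i x => c i * x) fun i => by fun_prop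
  have h1 := (hind2.restrict (Finset.range n)).charFun_map_fun_finsetSum_eq_prod
    fun i _ => ((hm i).const_mul (c i)).aemeasurable
  have h2 := congrFun h1 u
  simp only [Finset.prod_apply] at h2
  rw [h2]
  refine Finset.prod_congr rfl fun i _ => ?_
  have hst := (hY.stationaryIncrements (i * h) h).map_eq
  have hadd : (i : ℝ≥0) * h + h = (i + 1 : ℕ) * h := by push_cast; ring
  rw [hadd] at hst
  rw [charFun_map_mul_comp (hm i).aemeasurable, hst]

lemma charFun_nat_mul (hY : IsLevyProcess Y P) (h : ℝ≥0) (n : ℕ) (u : ℝ) :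
    charFun (P.map (Y (n * h))) u = charFun (P.map (Y h)) u ^ n := by
  have hs := hY.charFun_sum_increments (fun _ => 1) h n u
  simp only [one_mul, Finset.prod_const, Finset.card_range] at hs
  rw [← hs]
  congr 1
  refine Measure.map_congr ?_
  filter_upwards [hY.zero] with ω hω
  have := Finset.sum_range_sub (fun i : ℕ => Y (i * h) ω) n
  simp only [Nat.cast_zero, zero_mul, hω, sub_zero] at this
  exact this.symm

/-- Passing from time `1/(N n)` to `m/(N n)` only takes an `m`-th power, so no branch of a root is
chosen. -/
lemma charFun_rat_time (hY : IsLevyProcess Y P) {N : ℕ} {η : ℝ → ℂ} {u : ℝ}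
    (hη : ∀ n : ℕ, 0 < n →
      charFun (P.map (Y (1 / (N * n : ℕ)))) u = Complex.exp ((1 / (N * n : ℕ) : ℝ) • η u))
    (m : ℕ) {n : ℕ} (hn : 0 < n) :
    charFun (P.map (Y (m / (N * n : ℕ)))) u = Complex.exp ((m / (N * n : ℕ) : ℝ) • η u) := by
  rw [div_eq_mul_one_div, hY.charFun_nat_mul, hη n hn, ← Complex.exp_nat_mul, Complex.real_smul,
    Complex.real_smul]
  congr 1
  push_cast
  ring

lemma ae_tendsto_sum_expIntegral (hY : IsLevyProcess Y P) (T : ℝ≥0) :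
    ∀ᵐ ω ∂P, Tendsto (fun n : ℕ => ∑ i ∈ Finset.range n,
      Real.exp (-(i * (T / n))) * (Y ((i + 1 : ℕ) * (T / n)) ω - Y (i * (T / n)) ω))
      atTop (𝓝 (expIntegral (fun s => Y s ω) T)) :=
  hY.cadlag.mono fun _ hω => tendsto_sum_expIntegral hω T

lemma measurable_sum_increments (hY : IsLevyProcess Y P) (T : ℝ≥0) (n : ℕ) :
    Measurable fun ω => ∑ i ∈ Finset.range n,
      Real.exp (-(i * (T / n))) * (Y ((i + 1 : ℕ) * (T / n)) ω - Y (i * (T / n)) ω) :=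
  Finset.measurable_fun_sum _ fun _ _ => ((hY.measurable _).sub (hY.measurable _)).const_mul _

lemma aemeasurable_expIntegral (hY : IsLevyProcess Y P) (T : ℝ≥0) :
    AEMeasurable (fun ω => expIntegral (fun s => Y s ω) T) P :=
  aemeasurable_of_tendsto_metrizable_ae atTop
    (fun n => (hY.measurable_sum_increments T n).aemeasurable) (hY.ae_tendsto_sum_expIntegral T)

variable [IsProbabilityMeasure P]

/-- Near time `0` the characteristic functions are uniformly close to `1` on `[-1, 1]`. -/
lemma exists_norm_charFun_sub_one_le (hY : IsLevyProcess Y P) :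
    ∃ N : ℕ, 0 < N ∧ ∀ t : ℝ≥0, 0 < t → t ≤ 1 / N → ∀ u ∈ Icc (-1 : ℝ) 1,
      ‖charFun (P.map (Y t)) u - 1‖ ≤ 1 / 2 := by
  -- For `|u| ≤ 1`, `|e^(iuy) - 1| ≤ min |y| 2`: a bound uniform in `u`, which tends to `0` by
  -- right-continuity of the paths at time `0`.
  have hlim : Tendsto (fun t => ∫ ω, min |Y t ω| 2 ∂P) (𝓝[>] 0) (𝓝 (∫ _, (0 : ℝ) ∂P)) := by
    refine tendsto_integral_filter_of_dominated_convergence (fun _ => 2) ?_ ?_ (by simp) ?_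
    · refine Eventually.of_forall fun t => ?_
      have := hY.measurable t
      exact (by fun_prop : Measurable fun ω => min |Y t ω| 2).aestronglyMeasurable
    · refine Eventually.of_forall fun t => Eventually.of_forall fun ω => ?_
      rw [Real.norm_of_nonneg (by positivity)]
      exact min_le_right _ _
    · filter_upwards [hY.zero, hY.cadlag] with ω h0 hω
      have h := (hω 0).1.tendsto
      rw [h0] at h
      simpa using (h.abs.min (tendsto_const_nhds (x := (2 : ℝ))))
  rw [integral_zero] at hlim
  have hev := hlim.eventually (ge_mem_nhds (by norm_num : (0 : ℝ) < 1 / 2))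
  obtain ⟨δ, hδ, hball⟩ := (nhdsGT_basis (0 : ℝ≥0)).eventually_iff.1 hev
  obtain ⟨N, hN⟩ := exists_nat_one_div_lt (show (0 : ℝ) < δ from hδ)
  refine ⟨N + 1, N.succ_pos, fun t ht htN u hu => ?_⟩
  have htδ : t < δ := lt_of_le_of_lt htN (by
    rw [← NNReal.coe_lt_coe]; push_cast; exact hN)
  refine le_trans ?_ (hball ⟨ht, htδ⟩)
  have hm := hY.measurable t
  have hI : Integrable (fun ω => Complex.exp (u * Y t ω * Complex.I)) P := by
    refine (integrable_const (1 : ℝ)).mono' (by fun_prop) (Eventually.of_forall fun ω => ?_)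
    rw [← Complex.ofReal_mul, Complex.norm_exp_ofReal_mul_I]
  rw [charFun_apply_real, integral_map hm.aemeasurable (by fun_prop)]
  have h1 : ∫ ω, Complex.exp (u * Y t ω * Complex.I) ∂P - 1 =
      ∫ ω, (Complex.exp (u * Y t ω * Complex.I) - 1) ∂P := by
    rw [integral_sub hI (integrable_const _)]; simp
  rw [h1]
  refine norm_integral_le_of_norm_le ?_ (Eventually.of_forall fun ω => ?_)
  · refine (integrable_const (2 : ℝ)).mono' (by fun_prop) (Eventually.of_forall fun ω => ?_)
    rw [Real.norm_of_nonneg (by positivity)]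
    exact min_le_right _ _
  · refine le_min ?_ ?_
    · have := Real.norm_exp_I_mul_ofReal_sub_one_le (x := u * Y t ω)
      rw [mul_comm, Complex.ofReal_mul] at this
      refine this.trans ?_
      rw [norm_mul, Real.norm_eq_abs, Real.norm_eq_abs]
      exact mul_le_of_le_one_left (abs_nonneg _) (abs_le.2 hu)
    · refine (norm_sub_le _ _).trans ?_
      rw [← Complex.ofReal_mul, Complex.norm_exp_ofReal_mul_I]
      norm_num

/-- The characteristic exponent on `[-1, 1]`, along times `1 / (N * n)`. -/
lemma exists_charExponent (hY : IsLevyProcess Y P) :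
    ∃ N : ℕ, 0 < N ∧ ∃ η : ℝ → ℂ, Continuous η ∧ ∀ u ∈ Icc (-1 : ℝ) 1, ∀ n : ℕ, 0 < n →
      charFun (P.map (Y (1 / (N * n : ℕ)))) u = Complex.exp ((1 / (N * n : ℕ) : ℝ) • η u) := by
  obtain ⟨N, hN, hclose⟩ := hY.exists_norm_charFun_sub_one_le
  have hN0 : (0 : ℝ≥0) < N := by exact_mod_cast hN
  have hre : ∀ z : ℂ, ‖z - 1‖ ≤ 1 / 2 → 0 < z.re := fun z hz => by
    have := (Complex.abs_re_le_norm (z - 1)).trans hz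
    rw [Complex.sub_re, Complex.one_re, abs_le] at this
    linarith [this.1]
  have hprob : IsProbabilityMeasure (P.map (Y (1 / N))) :=
    Measure.isProbabilityMeasure_map (hY.measurable _).aemeasurable
  have hcont : ContinuousOn (fun u => (N : ℂ) * Complex.log (charFun (P.map (Y (1 / N))) u))
      (Icc (-1) 1) := by
    refine continuousOn_const.mul (ContinuousOn.clog continuous_charFun.continuousOn fun u hu => ?_)
    exact Or.inl (hre _ (hclose _ (by positivity) le_rfl u hu))
  have h11 : (-1 : ℝ) ≤ 1 := by norm_num
  -- The extension only serves to make `η` continuous on the whole line; its values are used on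
  -- `[-1, 1]`.
  refine ⟨N, hN, IccExtend h11 ((Icc (-1) 1).domRestrict
    fun u => (N : ℂ) * Complex.log (charFun (P.map (Y (1 / N))) u)),
    hcont.domRestrict.Icc_extend', fun u hu n hn => ?_⟩
  rw [IccExtend_of_mem _ _ hu]
  simp only [domRestrict_apply]
  have hn0 : (0 : ℝ≥0) < n := by exact_mod_cast hn
  set h : ℝ≥0 := 1 / (N * n : ℕ) with hh
  have hh0 : 0 < h := by rw [hh]; push_cast; positivity
  have hle : ∀ j : ℕ, j ≤ n → (j : ℝ≥0) * h ≤ 1 / N := fun j hj => by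
    calc (j : ℝ≥0) * h ≤ n * h := by gcongr
      _ = 1 / N := by rw [hh]; push_cast; field_simp
  have hpos : ∀ j : ℕ, 0 < j → j ≤ n → 0 < (charFun (P.map (Y h)) u ^ j).re := fun j hj hjn => by
    rw [← hY.charFun_nat_mul]
    exact hre _ (hclose _ (by positivity) (hle j hjn) u hu)
  -- All powers up to `n` are characteristic functions at times at most `1/N`, hence lie in the
  -- right half-plane. Two arguments below `π/2` add without leaving the principal branch.
  have hlog : ∀ j : ℕ, j ≤ n → Complex.log (charFun (P.map (Y h)) u ^ j) =
      j * Complex.log (charFun (P.map (Y h)) u) := fun j => by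
    induction j with
    | zero => simp
    | succ j ih =>
      intro hj
      rcases j.eq_zero_or_pos with rfl | hj0
      · simp
      have p1 := hpos j hj0 (by omega)
      have p2 := hpos 1 one_pos hn
      rw [pow_one] at p2
      have a1 := abs_lt.1 (Complex.abs_arg_lt_pi_div_two_iff.2 (Or.inl p1))
      have a2 := abs_lt.1 (Complex.abs_arg_lt_pi_div_two_iff.2 (Or.inl p2))
      rw [pow_succ, Complex.log_mul (fun h0 => by simp [h0] at p1) (fun h0 => by simp [h0] at p2)
        ⟨by linarith [a1.1, a2.1], by linarith [a1.2, a2.2]⟩, ih (by omega)]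
      push_cast
      ring
  have hnN : (n : ℝ≥0) * h = 1 / N := by rw [hh]; push_cast; field_simp
  have hl := hlog n le_rfl
  rw [← hY.charFun_nat_mul, hnN] at hl
  have hne : charFun (P.map (Y h)) u ≠ 0 := fun h0 => by
    have := hpos 1 one_pos hn
    simp [h0] at this
  rw [hl, Complex.real_smul]
  have hNc : (N : ℂ) ≠ 0 := by exact_mod_cast hN.ne'
  have hnc : (n : ℂ) ≠ 0 := by exact_mod_cast hn.ne'
  conv_lhs => rw [← Complex.exp_log hne]
  congr 1
  push_cast
  field_simp

/-- Independence of increments makes the characteristic function of a Stieltjes sum the exponential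
of a Riemann sum of `η(e⁻ˢu)`; both sides pass to the limit. -/
lemma charFun_expIntegral (hY : IsLevyProcess Y P) {N : ℕ} {η : ℝ → ℂ} (hηc : Continuous η)
    (hη : ∀ u ∈ Icc (-1 : ℝ) 1, ∀ n : ℕ, 0 < n →
      charFun (P.map (Y (1 / (N * n : ℕ)))) u = Complex.exp ((1 / (N * n : ℕ) : ℝ) • η u))
    (m : ℕ) {n : ℕ} (hn : 0 < n) {u : ℝ} (hu : u ∈ Icc (-1 : ℝ) 1) :
    charFun (P.map fun ω => expIntegral (fun s => Y s ω) (m / (N * n : ℕ))) u =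
      Complex.exp (∫ s in (0 : ℝ)..(m / (N * n : ℕ)), η (Real.exp (-s) * u)) := by
  set T : ℝ≥0 := m / (N * n : ℕ) with hT
  have hTr : (T : ℝ) = m / (N * n : ℕ) := by rw [hT]; push_cast; rfl
  have h1 := tendsto_charFun_of_ae_tendsto
    (fun n => (hY.measurable_sum_increments T n).aemeasurable) (hY.aemeasurable_expIntegral T)
    (hY.ae_tendsto_sum_expIntegral T) u
  have h2 := (Complex.continuous_exp.tendsto _).comp
    (tendsto_riemannSum (f := fun s => η (Real.exp (-s) * u)) (by fun_prop) T.coe_nonneg)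
  rw [← hTr]
  refine tendsto_nhds_unique h1 (h2.congr' ?_)
  filter_upwards [eventually_gt_atTop 0] with k hk
  have hs := hY.charFun_sum_increments (fun i => Real.exp (-(i * (T / k)))) (T / k) k u
  rw [hs, Function.comp_apply, Complex.exp_sum]
  refine Finset.prod_congr rfl fun i _ => ?_
  have hv : Real.exp (-(i * (T / k) : ℝ)) * u ∈ Icc (-1 : ℝ) 1 := by
    rw [mem_Icc, ← abs_le, abs_mul, Real.abs_exp]
    refine mul_le_one₀ ?_ (abs_nonneg _) (abs_le.2 hu)
    rw [Real.exp_le_one_iff]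
    have : (0 : ℝ) ≤ i * (T / k) := by positivity
    linarith
  -- Subdividing keeps the mesh among the times where `η` describes the law.
  have hTk : T / k = m / (N * (n * k) : ℕ) := by
    rw [hT, div_div]; push_cast; rw [mul_assoc]
  have h := hY.charFun_rat_time (hη _ hv) m (Nat.mul_pos hn hk)
  rw [← hTk] at h
  rw [h]
  congr 2
  rw [hTr, div_div]; push_cast; rw [mul_assoc]

/-- The self-decomposability relation for the limit of the exponential integrals. -/
lemma charFun_limit_eq (hY : IsLevyProcess Y P) {N : ℕ} (hN : 0 < N) {η : ℝ → ℂ}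
    (hηc : Continuous η)
    (hη : ∀ u ∈ Icc (-1 : ℝ) 1, ∀ n : ℕ, 0 < n →
      charFun (P.map (Y (1 / (N * n : ℕ)))) u = Complex.exp ((1 / (N * n : ℕ) : ℝ) • η u))
    {X : Ω → ℝ} (hX : AEMeasurable X P)
    (hlim : ∀ᵐ ω ∂P, Tendsto (fun T : ℝ≥0 => expIntegral (fun s => Y s ω) T) atTop (𝓝 (X ω)))
    {n : ℕ} (hn : 0 < n) {u : ℝ} (hu : u ∈ Icc (-1 : ℝ) 1) :
    charFun (P.map X) u =
      Complex.exp (∫ s in (0 : ℝ)..(1 / (N * n : ℕ)), η (Real.exp (-s) * u)) *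
        charFun (P.map X) (Real.exp (-(1 / (N * n : ℕ))) * u) := by
  have hM : 0 < N * n := Nat.mul_pos hN hn
  have htime : Tendsto (fun m : ℕ => (m / (N * n : ℕ) : ℝ≥0)) atTop atTop :=
    tendsto_natCast_atTop_atTop.atTop_div_const (by exact_mod_cast hM)
  have hlimφ : ∀ v ∈ Icc (-1 : ℝ) 1, Tendsto (fun m : ℕ =>
      Complex.exp (∫ s in (0 : ℝ)..(m / (N * n : ℕ)), η (Real.exp (-s) * v))) atTop
      (𝓝 (charFun (P.map X) v)) := fun v hv => by
    have h := tendsto_charFun_of_ae_tendsto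
      (fun m : ℕ => hY.aemeasurable_expIntegral (m / (N * n : ℕ) : ℝ≥0)) hX
      (hlim.mono fun ω hω => hω.comp htime) v
    exact h.congr fun m => hY.charFun_expIntegral hηc hη m hn hv
  set d : ℝ := 1 / (N * n : ℕ) with hd
  have hv : Real.exp (-d) * u ∈ Icc (-1 : ℝ) 1 := by
    rw [mem_Icc, ← abs_le, abs_mul, Real.abs_exp]
    refine mul_le_one₀ ?_ (abs_nonneg _) (abs_le.2 hu)
    rw [Real.exp_le_one_iff]
    have : 0 ≤ d := by positivity
    linarith
  -- The integral over `m + 1` steps splits into the first step and, after a shift by `d`, the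
  -- integral over `m` steps at `e⁻ᵈu`.
  refine tendsto_nhds_unique ((hlimφ u hu).comp (tendsto_add_atTop_nat 1))
    (((hlimφ _ hv).const_mul _).congr fun m => ?_)
  rw [← Complex.exp_add, Function.comp_apply]
  congr 1
  have hcont : Continuous fun s => η (Real.exp (-s) * u) := by fun_prop
  have hshift : ∫ s in (0 : ℝ)..(m / (N * n : ℕ)), η (Real.exp (-s) * (Real.exp (-d) * u)) =
      ∫ s in d..((m + 1 : ℕ) / (N * n : ℕ)), η (Real.exp (-s) * u) := by
    have h := intervalIntegral.integral_comp_add_right (a := 0) (b := m / (N * n : ℕ))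
      (fun s => η (Real.exp (-s) * u)) d
    rw [zero_add, show (m / (N * n : ℕ) : ℝ) + d = (m + 1 : ℕ) / (N * n : ℕ) by
      rw [hd]; push_cast; ring] at h
    rw [← h]
    refine intervalIntegral.integral_congr fun s _ => ?_
    rw [neg_add, Real.exp_add, mul_assoc]
  rw [hshift, intervalIntegral.integral_add_adjacent_intervals (hcont.intervalIntegrable _ _)
    (hcont.intervalIntegrable _ _)]

end IsLevyProcess

/-! ### Identification of the exponent -/

/-- The right-hand side of the hypothesis, as a function of a real time `t`, has derivative `η(u)
φ(u) - u φ'` at `0`. It returns to its value at `0` along times tending to `0`, so the slopes, and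
hence the derivative, vanish. -/
lemma exponent_mul_eq_of_selfdecomposable {φ η : ℝ → ℂ} (hη : Continuous η) {N : ℕ} (hN : 0 < N)
    {u : ℝ} {φ' : ℂ} (hφ : HasDerivAt φ φ' u)
    (h : ∀ n : ℕ, 0 < n → φ u =
      Complex.exp (∫ s in (0 : ℝ)..(1 / (N * n : ℕ)), η (Real.exp (-s) * u)) *
        φ (Real.exp (-(1 / (N * n : ℕ))) * u)) :
    η u * φ u = u * φ' := by
  set G : ℝ → ℂ := fun t =>
    Complex.exp (∫ s in (0 : ℝ)..t, η (Real.exp (-s) * u)) * φ (Real.exp (-t) * u) with hG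
  have hcont : Continuous fun s => η (Real.exp (-s) * u) := by fun_prop
  have h1 : HasDerivAt (fun t => ∫ s in (0 : ℝ)..t, η (Real.exp (-s) * u)) (η u) 0 := by
    simpa using hcont.integral_hasStrictDerivAt 0 0 |>.hasDerivAt
  have h2 : HasDerivAt (fun t : ℝ => Real.exp (-t) * u) (-u) 0 := by
    simpa using ((hasDerivAt_neg (0 : ℝ)).exp.mul_const u)
  have h3 : HasDerivAt (fun t => φ (Real.exp (-t) * u)) ((-u : ℝ) • φ') 0 := by
    refine HasDerivAt.scomp (0 : ℝ) (g₁ := φ) (h := fun t : ℝ => Real.exp (-t) * u) ?_ h2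
    simpa using hφ
  have hd : HasDerivAt G (η u * φ u - u * φ') 0 := by
    refine (h1.cexp.mul h3).congr_deriv ?_
    simp
    ring
  have hG0 : G 0 = φ u := by simp [hG]
  have ht : Tendsto (fun n : ℕ => (1 / (N * (n + 1) : ℕ) : ℝ)) atTop (𝓝[≠] 0) := by
    refine tendsto_nhdsWithin_iff.2 ⟨?_, Eventually.of_forall fun n => ?_⟩
    · have := (tendsto_one_div_add_atTop_nhds_zero_nat (𝕜 := ℝ)).const_mul (1 / (N : ℝ))
      rw [mul_zero] at this
      refine this.congr fun n => ?_
      push_cast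
      field_simp
    · have : 0 < N * (n + 1) := by positivity
      simp only [mem_compl_iff, mem_singleton_iff]
      positivity
  have hs := hd.tendsto_slope.comp ht
  have hz : Tendsto (slope G 0 ∘ fun n : ℕ => (1 / (N * (n + 1) : ℕ) : ℝ)) atTop (𝓝 0) := by
    refine tendsto_const_nhds.congr fun n => ?_
    have hn : G (1 / (N * (n + 1) : ℕ)) = φ u := (h (n + 1) n.succ_pos).symm
    rw [Function.comp_apply, slope_def_module, hn, hG0, sub_self, smul_zero]
  exact sub_eq_zero.1 (tendsto_nhds_unique hs hz)

/-- The characteristic exponent of the background driving distribution of `log γ_{α,lam}`. -/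
noncomputable def logGammaExponent (α lam u : ℝ) : ℂ :=
  u * Complex.I * (-(Real.log lam : ℂ) + Complex.digamma (α + u * Complex.I))

lemma hasDerivAt_charFun_logGammaLaw {α lam : ℝ} (hα : 0 < α) (hlam : 0 < lam) (u : ℝ) :
    HasDerivAt (charFun (logGammaLaw α lam))
      (Complex.I * (-(Real.log lam : ℂ) + Complex.digamma (α + u * Complex.I)) *
        charFun (logGammaLaw α lam) u) u := by
  have hz : 0 < ((α : ℂ) + u * Complex.I).re := by simpa using hα
  have hline : HasDerivAt (fun v : ℂ => (α : ℂ) + v * Complex.I) Complex.I (u : ℂ) := by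
    simpa using ((hasDerivAt_id (u : ℂ)).mul_const Complex.I).const_add (α : ℂ)
  have hG := (Complex.analyticAt_Gamma_of_re_pos hz).differentiableAt.hasDerivAt.comp (u : ℂ) hline
  have hE : HasDerivAt (fun v : ℂ => Complex.exp (-(v * Real.log lam * Complex.I)))
      (Complex.exp (-(u * Real.log lam * Complex.I)) * -(1 * Real.log lam * Complex.I)) (u : ℂ) :=
    ((((hasDerivAt_id (u : ℂ)).mul_const _).mul_const _).fun_neg).cexp
  have h := ((hE.mul hG).div_const (Complex.Gamma α)).comp_ofReal
  have hne := Complex.Gamma_ne_zero (Complex.ne_neg_natCast_of_re_pos hz)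
  rw [show charFun (logGammaLaw α lam) = _ from funext (charFun_logGammaLaw hα hlam)]
  refine h.congr_deriv ?_
  simp only [Complex.digamma_def, logDeriv_apply, Function.comp_apply]
  field_simp

lemma charFun_backgroundDrivingDistribution {α lam : ℝ} (hα : 0 < α) (hlam : 0 < lam)
    {Ω : Type*} [MeasurableSpace Ω] {P : Measure Ω} [IsProbabilityMeasure P]
    {Y : ℝ≥0 → Ω → ℝ} (hY : IsBackgroundDrivingLevyProcess Y P (logGammaLaw α lam))
    {u : ℝ} (hu : u ∈ Icc (-1 : ℝ) 1) :
    charFun (backgroundDrivingDistribution Y P) u = Complex.exp (logGammaExponent α lam u) := by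
  obtain ⟨X, hX, hlim⟩ := hY.randomIntegral
  have hL := hY.isLevyProcess
  obtain ⟨N, hN, η, hηc, hη⟩ := hL.exists_charExponent
  have hd := hasDerivAt_charFun_logGammaLaw hα hlam u
  have hη' : η u = logGammaExponent α lam u := by
    have hrel := fun (n : ℕ) (hn : 0 < n) =>
      hL.charFun_limit_eq hN hηc hη hX.aemeasurable hlim hn hu
    rw [hX.map_eq] at hrel
    have h := exponent_mul_eq_of_selfdecomposable hηc hN hd hrel
    have hne : charFun (logGammaLaw α lam) u ≠ 0 := by
      rw [charFun_logGammaLaw hα hlam]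
      exact div_ne_zero (mul_ne_zero (Complex.exp_ne_zero _)
        (Complex.Gamma_ne_zero (Complex.ne_neg_natCast_of_re_pos (by simpa using hα))))
        (Complex.Gamma_ne_zero (Complex.ne_neg_natCast_of_re_pos (by simpa using hα)))
    refine mul_right_cancel₀ hne (h.trans ?_)
    rw [logGammaExponent]
    ring
  -- Time `1` is `N/(N · 1)`.
  have h1 := hL.charFun_rat_time (hη u hu) N one_pos
  have hNr : (N : ℝ) ≠ 0 := by exact_mod_cast hN.ne'
  have hNn : (N : ℝ≥0) ≠ 0 := by exact_mod_cast hN.ne'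
  rw [mul_one, div_self hNr, div_self hNn, one_smul, hη'] at h1
  exact h1

/-! ### Derivatives of the exponent and the conclusion -/

section Exponent

variable {α : ℝ} (lam : ℝ)

lemma hasDerivAt_comp_add_mul_I (hα : 0 < α) {g g' : ℂ → ℂ}
    (hg : ∀ z : ℂ, 0 < z.re → HasDerivAt g (g' z) z) (u : ℝ) :
    HasDerivAt (fun u : ℝ => g (α + u * Complex.I)) (g' (α + u * Complex.I) * Complex.I) u := by
  have hline : HasDerivAt (fun v : ℂ => (α : ℂ) + v * Complex.I) Complex.I (u : ℂ) := by
    simpa using ((hasDerivAt_id (u : ℂ)).mul_const Complex.I).const_add (α : ℂ)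
  exact ((hg _ (by simpa using hα)).comp (u : ℂ) hline).comp_ofReal

lemma contDiffAt_logGammaExponent (hα : 0 < α) :
    ContDiffAt ℝ (⊤ : ℕ∞) (logGammaExponent α lam) 0 := by
  have hcoe : ContDiffAt ℝ (⊤ : ℕ∞) (fun u : ℝ => (u : ℂ)) 0 := Complex.ofRealCLM.contDiff.contDiffAt
  have hline : ContDiffAt ℝ (⊤ : ℕ∞) (fun u : ℝ => (α : ℂ) + u * Complex.I) 0 :=
    contDiffAt_const.add (hcoe.mul contDiffAt_const)
  have hψ : ContDiffAt ℝ (⊤ : ℕ∞) Complex.digamma ((α : ℂ) + (0 : ℝ) * Complex.I) :=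
    (Complex.analyticAt_digamma_of_re_pos (by simpa using hα)).contDiffAt.restrict_scalars ℝ
  exact (hcoe.mul contDiffAt_const).mul (contDiffAt_const.add (hψ.comp 0 hline))

lemma hasDerivAt_logGammaExponent (hα : 0 < α) (u : ℝ) :
    HasDerivAt (logGammaExponent α lam)
      (Complex.I * (-(Real.log lam : ℂ) + Complex.digamma (α + u * Complex.I)) -
        u * deriv Complex.digamma (α + u * Complex.I)) u := by
  have h1 := hasDerivAt_comp_add_mul_I hα (g := Complex.digamma) (g' := deriv Complex.digamma)
    (fun z hz => (Complex.analyticAt_digamma_of_re_pos hz).differentiableAt.hasDerivAt) u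
  have h2 := ((Complex.ofRealCLM.hasDerivAt (x := u)).mul_const Complex.I).mul
    (h1.const_add (-(Real.log lam : ℂ)))
  refine h2.congr_deriv ?_
  simp only [Complex.ofRealCLM_apply, Complex.ofReal_one]
  linear_combination (u * deriv Complex.digamma (α + u * Complex.I)) * Complex.I_sq

lemma hasDerivAt_deriv_logGammaExponent_zero (hα : 0 < α) :
    HasDerivAt (deriv (logGammaExponent α lam))
      (-2 * ((∑' n : ℕ, 1 / (α + n) ^ 2 : ℝ) : ℂ)) 0 := by
  rw [show deriv (logGammaExponent α lam) = _ from
    funext fun u => (hasDerivAt_logGammaExponent lam hα u).deriv]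
  have h1 := hasDerivAt_comp_add_mul_I hα (g := Complex.digamma) (g' := deriv Complex.digamma)
    (fun z hz => (Complex.analyticAt_digamma_of_re_pos hz).differentiableAt.hasDerivAt) 0
  have h2 := hasDerivAt_comp_add_mul_I hα (g := deriv Complex.digamma)
    (g' := deriv (deriv Complex.digamma))
    (fun z hz => (Complex.analyticAt_digamma_of_re_pos hz).deriv.differentiableAt.hasDerivAt) 0
  have h3 := ((h1.const_add (-(Real.log lam : ℂ))).const_mul Complex.I).sub
    ((Complex.ofRealCLM.hasDerivAt (x := (0 : ℝ))).mul h2)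
  refine h3.congr_deriv ?_
  simp only [Complex.ofRealCLM_apply, Complex.ofReal_one, Complex.ofReal_zero, zero_mul, add_zero,
    (Complex.hasDerivAt_digamma_ofReal hα).deriv, one_mul]
  -- Each of the two terms of the first derivative contributes `-ψ'(α)`, which is the source of the
  -- factor `2`.
  linear_combination ((∑' n : ℕ, 1 / (α + n) ^ 2 : ℝ) : ℂ) * Complex.I_sq

end Exponent

theorem corollary3 {α lam : ℝ} (hα : 0 < α) (hlam : 0 < lam)
    {Ω : Type*} [MeasurableSpace Ω] {P : Measure Ω} [IsProbabilityMeasure P]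
    {Y : ℝ≥0 → Ω → ℝ} (hY : IsBackgroundDrivingLevyProcess Y P (logGammaLaw α lam)) :
    (Integrable (fun x : ℝ => x) (backgroundDrivingDistribution Y P) ∧
      ((∫ x, x ∂(backgroundDrivingDistribution Y P) : ℝ) : ℂ)
        = -(Real.log lam : ℂ) + Complex.digamma (α : ℂ)) ∧
    (MemLp (fun x : ℝ => x) 2 (backgroundDrivingDistribution Y P) ∧
      IntegrableOn (fun x : ℝ => x ^ 2 * Real.exp (-α * x) * (α + (1 - α) * Real.exp (-x)) *
        ((1 - Real.exp (-x)) ^ 2)⁻¹) (Ioi 0) ∧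
      variance (fun x : ℝ => x) (backgroundDrivingDistribution Y P)
        = ∫ x in Ioi (0 : ℝ), x ^ 2 * Real.exp (-α * x) * (α + (1 - α) * Real.exp (-x)) *
            ((1 - Real.exp (-x)) ^ 2)⁻¹) ∧
    (∀ β : ℝ, 0 < β →
      Integrable (fun x : ℝ => |x| ^ β) (backgroundDrivingDistribution Y P)) := by
  have hprob : IsProbabilityMeasure (backgroundDrivingDistribution Y P) :=
    Measure.isProbabilityMeasure_map (hY.isLevyProcess.measurable 1).aemeasurable
  have hφ : charFun (backgroundDrivingDistribution Y P) =ᶠ[𝓝 0]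
      fun u => Complex.exp (logGammaExponent α lam u) := by
    filter_upwards [Icc_mem_nhds (by norm_num : (-1 : ℝ) < 0) one_pos] with u hu
    exact charFun_backgroundDrivingDistribution hα hlam hY hu
  set G := backgroundDrivingDistribution Y P
  have hsmooth : ContDiffAt ℝ (⊤ : ℕ∞) (charFun G) 0 := by
    refine ContDiffAt.congr_of_eventuallyEq ?_ hφ
    exact (contDiffAt_logGammaExponent lam hα).cexp
  have hmem : ∀ n : ℕ, MemLp (fun x : ℝ => x) n G := memLp_of_contDiffAt_charFun hsmooth
  have h2 : MemLp (fun x : ℝ => x) 2 G := by exact_mod_cast hmem 2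
  have hE0 : logGammaExponent α lam 0 = 0 := by simp [logGammaExponent]
  have hderiv : deriv (charFun G) =ᶠ[𝓝 0] fun u =>
      Complex.exp (logGammaExponent α lam u) * deriv (logGammaExponent α lam) u := by
    filter_upwards [hφ.eventuallyEq_nhds] with u hu
    rw [hu.deriv_eq]
    have := hasDerivAt_logGammaExponent lam hα u
    rw [this.deriv]
    exact this.cexp.deriv
  have hd0 : deriv (logGammaExponent α lam) 0 =
      Complex.I * (-(Real.log lam : ℂ) + Complex.digamma α) := by
    rw [(hasDerivAt_logGammaExponent lam hα 0).deriv]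
    simp
  have hmean : ((∫ x, x ∂G : ℝ) : ℂ) = -(Real.log lam : ℂ) + Complex.digamma (α : ℂ) := by
    have h := iteratedDeriv_charFun_zero (μ := G) (n := 1) (hmem 1)
    rw [iteratedDeriv_one, hderiv.eq_of_nhds, hE0, hd0, Complex.exp_zero, one_mul, pow_one] at h
    simpa using (mul_left_cancel₀ Complex.I_ne_zero h).symm
  -- Compare `(exp η)''(0) = η'(0)² + η''(0)` with `i²` times the second moment, where `η'(0)` is
  -- `i` times the mean.
  have hsq : ∫ x, x ^ 2 ∂G = (∫ x, x ∂G) ^ 2 + 2 * ∑' n : ℕ, 1 / (α + n) ^ 2 := by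
    have h := iteratedDeriv_charFun_zero (μ := G) (n := 2) (hmem 2)
    have hE := (hasDerivAt_logGammaExponent lam hα 0).differentiableAt.hasDerivAt.cexp
    rw [iteratedDeriv_succ, iteratedDeriv_one, hderiv.deriv_eq,
      (hE.fun_mul (hasDerivAt_deriv_logGammaExponent_zero lam hα)).deriv, hE0, hd0, ← hmean,
      Complex.exp_zero, Complex.I_sq] at h
    have h' : ((∫ x, x ^ 2 ∂G : ℝ) : ℂ) =
        (((∫ x, x ∂G) ^ 2 + 2 * ∑' n : ℕ, 1 / (α + n) ^ 2 : ℝ) : ℂ) := by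
      rw [Complex.ofReal_add, Complex.ofReal_mul, Complex.ofReal_pow, Complex.ofReal_ofNat]
      linear_combination h - ((∫ x, x ∂G : ℝ) : ℂ) ^ 2 * Complex.I_sq
    exact_mod_cast h'
  refine ⟨⟨h2.integrable (by norm_num), hmean⟩, ⟨h2, integrableOn_trigamma hα, ?_⟩, fun β hβ => ?_⟩
  · rw [integral_trigamma hα, variance_eq_sub h2]
    simp only [Pi.pow_apply]
    linarith
  · obtain ⟨n, hn⟩ := exists_nat_ge β
    have hm : MemLp (fun x : ℝ => x) (ENNReal.ofReal β) G :=
      (hmem n).mono_exponent (ENNReal.ofReal_le_of_le_toReal (by simpa using hn))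
    have := hm.integrable_norm_rpow (by simpa using hβ) ENNReal.ofReal_ne_top
    simpa [ENNReal.toReal_ofReal hβ.le] using this
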